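/- For $N\ge 1$ let $\mathsf{GT}:[N]\times[N]\to\{0,1\}$ be given by $\mathsf{GT}(x,y)=1$ if $x>y$ and $\mathsf{GT}(x,y)=0$ if $x\le y$. For a probability distribution $\mu$ on $[N]$, let $Q_{\mu,1/3}(\mathsf{GT})$ be the minimum number of queries made by a quantum algorithm that, given access to the oracle $U_x:|y\rangle|a\rangle\mapsto|y\rangle|a\oplus \mathsf{GT}(x,y)\rangle$ for an unknown $x$, outputs $x$ with failure probability at most $1/3$, where the probability is over both the draw $x\sim\mu$ and the internal randomness (final measurement) of the algorithm. For $\epsilon>0$ let $$H_{\max}^{\epsilon}(\mu)=\min\{\log_2|\operatorname{supp}(\nu)| : \nu \text{ a probability distribution on } [N] \text{ with } \tfrac12\textstyle\sum_x|\mu(x)-\nu(x)|\le\epsilon\}$$ be the $\epsilon$-smooth max-entropy of $\mu$. **Proposition.** $Q_{\mu,1/3}(\mathsf{GT})\ge\Omega\big(H_{\max}^{1/2}(\mu)\big)$. That is, there is a universal constant $c>0$ such that for every $N\ge1$ and every probability distribution $\mu$ on $[N]$, $$Q_{\mu,1/3}(\mathsf{GT})\ \ge\ c\cdot H_{\max}^{1/2}(\mu).$$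 -/

import Mathlib

open scoped ENNReal

namespace QuantumQuery

noncomputable section

/-- The labels of the computational basis of an algorithm's state space
`ℂ^|Y| ⊗ ℂ^k ⊗ ℂ^d`: query register, answer register, workspace. -/
abbrev Basis (Y : Type*) (k d : ℕ) : Type _ := Y × ZMod k × Fin d

/-- The oracle unitary `U_g ⊗ I`, which sends `|y⟩|a⟩|w⟩` to `|y⟩|a + g y mod k⟩|w⟩`. -/
def oracle {Y : Type*} [DecidableEq Y] {k : ℕ} (d : ℕ) (g : Y → ZMod k) :
    Matrix (Basis Y k d) (Basis Y k d) ℂ :=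
  Matrix.of fun p q => if p = (q.1, q.2.1 + g q.1, q.2.2) then 1 else 0

/-- A quantum query algorithm with queries in `Y`, answers in `ZMod k` and outputs in `X`.
It starts in a fixed computational basis state, alternates input-independent unitaries
`unitary 0, unitary 1, …, unitary queries` with `queries` applications of the oracle, and then
measures in the computational basis; the measured label determines the output. The workspace
dimension is arbitrary (finite). -/
structure Algorithm (X Y : Type*) [Fintype Y] [DecidableEq Y] (k : ℕ) [NeZero k] where
  /-- dimension of the workspace -/
  dim : ℕ
  /-- number of queries -/
  queries : ℕ
  /-- initial basis state -/
  start : Basis Y k dim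
  /-- input-independent unitaries (only the indices `0, …, queries` are used) -/
  unitary : ℕ → Matrix.unitaryGroup (Basis Y k dim) ℂ
  /-- output read off from the measured basis label -/
  output : Basis Y k dim → X

namespace Algorithm

variable {X Y : Type*} [Fintype Y] [DecidableEq Y] {k : ℕ} [NeZero k]

/-- The state after `t` queries to the oracle for `g` (and the unitary that follows them). -/
def state (A : Algorithm X Y k) (g : Y → ZMod k) : ℕ → Basis Y k A.dim → ℂ
  | 0 => Matrix.mulVec (A.unitary 0 : Matrix _ _ ℂ) (Pi.single A.start 1)
  | t + 1 => Matrix.mulVec (A.unitary (t + 1) : Matrix _ _ ℂ)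
      (Matrix.mulVec (oracle A.dim g) (A.state g t))

/-- The probability (Born rule) that the algorithm, run with the oracle for `g`, does not
output `x`. -/
def failureProb [DecidableEq X] (A : Algorithm X Y k) (g : Y → ZMod k) (x : X) : ℝ :=
  ∑ b : Basis Y k A.dim, if A.output b = x then 0 else ‖A.state g A.queries b‖ ^ 2

/-- The failure probability in identifying `x` from the oracle `f x`, when `x` is drawn
from `μ`; it is taken over both `x` and the measurement. -/
def avgFailureProb [Fintype X] [DecidableEq X] (A : Algorithm X Y k) (f : X → Y → ZMod k)
    (μ : PMF X) : ℝ :=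
  ∑ x : X, (μ x).toReal * A.failureProb (f x) x

end Algorithm

/-- The distributional complexity of the oracle identification problem of `f`: the minimum number
of queries of an algorithm whose failure probability on `x ∼ μ` is at most `ε`
(`⊤` if there is none). -/
def distComplexity {X Y : Type*} [Fintype X] [DecidableEq X] [Fintype Y] [DecidableEq Y]
    {k : ℕ} [NeZero k] (f : X → Y → ZMod k) (μ : PMF X) (ε : ℝ) : ℕ∞ :=
  ⨅ A : {A : Algorithm X Y k // A.avgFailureProb f μ ≤ ε}, (A.1.queries : ℕ∞)

/-- Total variation distance of two distributions on a finite set. -/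
def tvDist {X : Type*} [Fintype X] (μ ν : PMF X) : ℝ :=
  (1 / 2) * ∑ x : X, |(μ x).toReal - (ν x).toReal|

/-- The `ε`-smooth max-entropy of `μ`: the minimum of `log₂ |supp ν|` over the distributions `ν`
that are `ε`-close to `μ` in total variation distance. -/
def smoothMaxEntropy {X : Type*} [Fintype X] (ε : ℝ) (μ : PMF X) : ℝ :=
  sInf {h : ℝ | ∃ ν : PMF X, tvDist μ ν ≤ ε ∧ h = Real.logb 2 (ν.support.ncard : ℝ)}

/-- The greater-than function on `N` ordered elements. -/
def GT (N : ℕ) (x y : Fin N) : ZMod 2 := if y < x then 1 else 0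

end

end QuantumQuery

/-! This is an adversary argument with the Hilbert kernel. Let `S` be the `M` inputs on which the
algorithm succeeds with probability at least 1/4. Number them in increasing order and put weight
`1/|i - j|` on the pair `i, j`. The progress is the weighted sum of the overlaps of the states. It
starts at no less than `M log M`, since each row of the kernel is harmonic. A query at `y` separates
only pairs on opposite sides of `y`; across such a cut the kernel is a piece of Hilbert's matrix, of
bounded norm, so each query costs `O(M)`. At the end, failing components keep at most 3/4 of the row
sums, and succeeding ones add only `O(M)` because the squared weights in a row are summable. Hence
`log M = O(queries + 1)` (`log_card_le_of_failureProb_le`). By averaging, `S` has mass at least 1/2,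
so conditioning `μ` on `S` bounds the smooth max-entropy by `log₂ M`. -/

namespace QuantumQuery

open Finset

/-! ### Norm, row sums and square row sums of the Hilbert kernel -/

section Kernel

/-- Schur test: AM-GM weighted by `w j / w i` on each product `n i * n j`; by symmetry of `K` both
halves give the same sum. -/
theorem sum_mul_mul_le_of_schur {ι : Type*} [Fintype ι] (K : ι → ι → ℝ)
    (hK : ∀ i j, 0 ≤ K i j) (hsymm : ∀ i j, K i j = K j i) (w : ι → ℝ) (hw : ∀ i, 0 < w i)
    (C : ℝ) (hC : ∀ i, ∑ j, K i j * w j ≤ C * w i) (n : ι → ℝ) :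
    ∑ i, ∑ j, K i j * (n i * n j) ≤ C * ∑ i, n i ^ 2 := by
  have key : ∀ i j, K i j * (n i * n j) ≤
      (K i j * w j * (n i ^ 2 / w i) + K j i * w i * (n j ^ 2 / w j)) / 2 := by
    intro i j
    rw [hsymm j i]
    have hi := hw i
    have hj := hw j
    have h : n i * n j ≤ (w j * (n i ^ 2 / w i) + w i * (n j ^ 2 / w j)) / 2 := by
      have : (w j * (n i ^ 2 / w i) + w i * (n j ^ 2 / w j)) / 2 - n i * n j =
          (w j * n i - w i * n j) ^ 2 / (2 * (w i * w j)) := by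
        field_simp
        ring
      have h2 : 0 ≤ (w j * n i - w i * n j) ^ 2 / (2 * (w i * w j)) := by positivity
      linarith
    calc K i j * (n i * n j) ≤ K i j * ((w j * (n i ^ 2 / w i) + w i * (n j ^ 2 / w j)) / 2) :=
          mul_le_mul_of_nonneg_left h (hK i j)
      _ = _ := by ring
  have hrow : ∑ i, ∑ j, K i j * w j * (n i ^ 2 / w i) ≤ C * ∑ i, n i ^ 2 := by
    rw [mul_sum]
    refine sum_le_sum fun i _ => ?_
    rw [← sum_mul]
    calc (∑ j, K i j * w j) * (n i ^ 2 / w i) ≤ C * w i * (n i ^ 2 / w i) :=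
          mul_le_mul_of_nonneg_right (hC i) (div_nonneg (sq_nonneg _) (hw i).le)
      _ = C * n i ^ 2 := by
          have := (hw i).ne'
          field_simp
  calc ∑ i, ∑ j, K i j * (n i * n j)
      ≤ ∑ i, ∑ j, (K i j * w j * (n i ^ 2 / w i) + K j i * w i * (n j ^ 2 / w j)) / 2 :=
        sum_le_sum fun i _ => sum_le_sum fun j _ => key i j
    _ = (∑ i, ∑ j, K i j * w j * (n i ^ 2 / w i) +
          ∑ i, ∑ j, K j i * w i * (n j ^ 2 / w j)) / 2 := by
        simp only [← sum_div, sum_add_distrib]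
    _ = ∑ i, ∑ j, K i j * w j * (n i ^ 2 / w i) := by
        rw [sum_comm (f := fun i j => K j i * w i * (n j ^ 2 / w j))]
        ring
    _ ≤ _ := hrow

theorem sqrt_succ_sub_sqrt_pos (b : ℕ) : 0 < √((b : ℝ) + 1) - √(b : ℝ) :=
  sub_pos.2 (Real.sqrt_lt_sqrt (Nat.cast_nonneg b) (by linarith))

/-- The classical Schur weight for Hilbert's matrix is `b^(-1/2)`. Its discrete form `√(b+1) - √b`
lets the row sum telescope against `4 / (√(a+1) + √b)`. -/
theorem sum_sqrt_sub_sqrt_div_le (a n : ℕ) :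
    ∑ b ∈ range n, ((a : ℝ) + b + 1)⁻¹ * (√((b : ℝ) + 1) - √(b : ℝ)) ≤
      8 * (√((a : ℝ) + 1) - √(a : ℝ)) := by
  set A : ℝ := √((a : ℝ) + 1) with hA
  have hApos : 0 < A := Real.sqrt_pos.2 (by positivity)
  have hA2 : A ^ 2 = a + 1 := Real.sq_sqrt (by positivity)
  have step : ∀ b : ℕ, ((a : ℝ) + b + 1)⁻¹ * (√((b : ℝ) + 1) - √(b : ℝ)) ≤
      4 * (A + √(b : ℝ))⁻¹ - 4 * (A + √((b + 1 : ℕ) : ℝ))⁻¹ := by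
    intro b
    push_cast
    have hs := Real.sqrt_nonneg (b : ℝ)
    have hlt := sqrt_succ_sub_sqrt_pos b
    have hs2 : √((b : ℝ) + 1) ^ 2 = b + 1 := Real.sq_sqrt (by positivity)
    set s := √(b : ℝ)
    set r := √((b : ℝ) + 1)
    have ha : (0 : ℝ) ≤ a := Nat.cast_nonneg a
    have hb : (0 : ℝ) ≤ b := Nat.cast_nonneg b
    have h1 : (A + s) * (A + r) ≤ 4 * ((a : ℝ) + b + 1) := by
      nlinarith [sq_nonneg (A - r), mul_pos (add_pos hApos (by linarith : 0 < r)) hlt]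
    have h2 : 4 * (A + s)⁻¹ - 4 * (A + r)⁻¹ = 4 * ((A + s) * (A + r))⁻¹ * (r - s) := by
      have : A + s ≠ 0 := by positivity
      have : A + r ≠ 0 := by linarith
      field_simp
      ring
    rw [h2]
    refine mul_le_mul_of_nonneg_right ?_ hlt.le
    have h3 : 0 < (A + s) * (A + r) := mul_pos (by positivity) (by linarith)
    rw [← div_eq_mul_inv, le_div_iff₀ h3, inv_mul_le_iff₀ (by positivity)]
    linarith
  have tele : ∑ b ∈ range n, ((a : ℝ) + b + 1)⁻¹ * (√((b : ℝ) + 1) - √(b : ℝ)) ≤ 4 * A⁻¹ := by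
    refine (sum_le_sum fun b _ => step b).trans ?_
    rw [sum_range_sub' (fun b : ℕ => 4 * (A + √(b : ℝ))⁻¹)]
    simp only [Nat.cast_zero, Real.sqrt_zero, add_zero]
    have : 0 ≤ 4 * (A + √(n : ℝ))⁻¹ := by positivity
    linarith
  refine tele.trans ?_
  have hs := Real.sqrt_nonneg (a : ℝ)
  have hs2 : √(a : ℝ) ^ 2 = a := Real.sq_sqrt (Nat.cast_nonneg a)
  have hlt := sqrt_succ_sub_sqrt_pos a
  rw [← hA] at hlt
  -- `(A - √a)(A + √a) = 1` and `A + √a ≤ 2A` give `1/A ≤ 2(A - √a)`.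
  rw [← div_eq_mul_inv, div_le_iff₀ hApos]
  nlinarith

/-- Hilbert's inequality for a cut of a finite linear order into two intervals. -/
theorem sum_cut_inv_abs_sub_le {M : ℕ} (P : Fin M → Prop) [DecidablePred P]
    (hP : ∀ i j, i ≤ j → P j → P i) (n : Fin M → ℝ) :
    ∑ i, ∑ j, (if (P i ↔ P j) then 0 else |(i : ℝ) - j|⁻¹) * (n i * n j) ≤
      8 * ∑ i, n i ^ 2 := by
  obtain ⟨s, hs⟩ : ∃ s : ℕ, ∀ i : Fin M, P i ↔ (i : ℕ) < s := by
    by_cases h : ∃ m, ∃ hm : m < M, ¬ P ⟨m, hm⟩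
    · classical
      refine ⟨Nat.find h, fun i => ⟨fun hi => ?_, fun hi => ?_⟩⟩
      · obtain ⟨hm, hn⟩ := Nat.find_spec h
        by_contra hlt
        exact hn (hP ⟨_, hm⟩ i (Fin.mk_le_of_le_val (not_lt.1 hlt)) hi)
      · have := Nat.find_min h hi
        push Not at this
        exact this i.2
    · push Not at h
      exact ⟨M, fun i => ⟨fun _ => i.2, fun _ => h i i.2⟩⟩
  simp only [hs]
  -- Positions are counted outwards from the cut on either side, so across it the kernel becomes
  -- `1/(a + b + 1)`.
  let pos : Fin M → ℕ := fun i => if (i : ℕ) < s then s - 1 - i else i - s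
  have hpos : ∀ i j : Fin M, ¬ ((i : ℕ) < s ↔ (j : ℕ) < s) →
      |(i : ℝ) - j| = (pos i : ℝ) + pos j + 1 := by
    intro i j h
    have h1 : |(i : ℤ) - j| = (pos i : ℤ) + pos j + 1 := by
      simp only [pos]
      split_ifs <;> first | omega | (rw [abs_eq (by omega)]; omega)
    exact_mod_cast h1
  refine sum_mul_mul_le_of_schur _ (fun i j => ?_) (fun i j => ?_)
    (fun i => √((pos i : ℝ) + 1) - √(pos i : ℝ)) (fun i => sqrt_succ_sub_sqrt_pos _) 8
    (fun i => ?_) n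
  · split_ifs <;> positivity
  · rw [abs_sub_comm]
    exact if_congr iff_comm rfl rfl
  · refine le_trans ?_ (sum_sqrt_sub_sqrt_div_le (pos i) M)
    let F : ℕ → ℝ := fun b => ((pos i : ℝ) + b + 1)⁻¹ * (√((b : ℝ) + 1) - √(b : ℝ))
    have hF : ∀ b, 0 ≤ F b := fun b =>
      mul_nonneg (by positivity) (sqrt_succ_sub_sqrt_pos b).le
    let T : Finset (Fin M) := univ.filter fun j => ¬ ((i : ℕ) < s ↔ (j : ℕ) < s)
    have h1 : ∑ j : Fin M, (if ((i : ℕ) < s ↔ (j : ℕ) < s) then 0 else |(i : ℝ) - j|⁻¹) *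
        (√((pos j : ℝ) + 1) - √(pos j : ℝ)) = ∑ j ∈ T, F (pos j) := by
      rw [sum_filter]
      refine sum_congr rfl fun j _ => ?_
      by_cases h : ((i : ℕ) < s ↔ (j : ℕ) < s)
      · rw [if_pos h, zero_mul, if_neg (not_not.2 h)]
      · rw [if_neg h, if_pos h, hpos i j h]
    have hinj : Set.InjOn pos T := by
      intro j hj k hk hjk
      simp only [T, coe_filter, mem_univ, true_and, Set.mem_ofPred_eq] at hj hk
      simp only [pos] at hjk
      apply Fin.ext
      split_ifs at hjk <;> omega
    rw [h1, ← sum_image (f := F) hinj]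
    refine sum_le_sum_of_subset_of_nonneg (fun b hb => ?_) fun b _ _ => hF b
    obtain ⟨j, hj, rfl⟩ := mem_image.1 hb
    simp only [T, mem_filter, mem_univ, true_and] at hj
    have := i.2
    have := j.2
    simp only [mem_range, pos]
    split_ifs <;> omega

theorem sum_fin_abs_sub {M : ℕ} (φ : ℝ → ℝ) (h0 : φ 0 = 0) (i : Fin M) :
    ∑ j : Fin M, φ |(i : ℝ) - j| =
      ∑ k ∈ range i, φ (k + 1) + ∑ k ∈ range (M - 1 - i), φ (k + 1) := by
  obtain ⟨i, hi⟩ := i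
  obtain ⟨m, rfl⟩ : ∃ m, M = i + 1 + m := ⟨M - (i + 1), by omega⟩
  rw [Fin.sum_univ_eq_sum_range (fun j => φ |(i : ℝ) - j|), sum_range_add, sum_range_succ]
  simp only [sub_self, abs_zero, h0, add_zero]
  rw [show i + 1 + m - 1 - i = m by omega, ← sum_range_reflect (fun k : ℕ => φ ((k : ℝ) + 1)) i]
  congr 1
  · refine sum_congr rfl fun j hj => ?_
    have hj := mem_range.1 hj
    congr 1
    rw [Nat.sub_sub, Nat.cast_sub (by omega), abs_of_nonneg]
    · push_cast
      ring
    · exact sub_nonneg.2 (by exact_mod_cast hj.le)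
  · refine sum_congr rfl fun k _ => ?_
    congr 1
    push_cast
    rw [abs_sub_comm, abs_of_nonneg] <;> linarith [(Nat.cast_nonneg k : (0 : ℝ) ≤ k)]

theorem log_add_one_le_sum_inv (n : ℕ) :
    Real.log ((n : ℝ) + 1) ≤ ∑ k ∈ range n, ((k : ℝ) + 1)⁻¹ := by
  have h := log_add_one_le_harmonic n
  rw [harmonic] at h
  push_cast at h
  exact h

/-- The row splits at `i` into two harmonic sums, and `(i + 1)(M - i) ≥ M`. The diagonal term
vanishes because `0⁻¹ = 0`. -/
theorem log_le_sum_inv_abs_sub {M : ℕ} (i : Fin M) :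
    Real.log M ≤ ∑ j : Fin M, |(i : ℝ) - j|⁻¹ := by
  rw [sum_fin_abs_sub (fun x => x⁻¹) inv_zero i]
  obtain ⟨i, hi⟩ := i
  obtain ⟨m, rfl⟩ : ∃ m, M = i + 1 + m := ⟨M - (i + 1), by omega⟩
  rw [show i + 1 + m - 1 - i = m by omega]
  refine le_trans ?_ (add_le_add (log_add_one_le_sum_inv i) (log_add_one_le_sum_inv m))
  rw [← Real.log_mul (by positivity) (by positivity)]
  refine Real.log_le_log (by positivity) ?_
  push_cast
  nlinarith [mul_nonneg (Nat.cast_nonneg (α := ℝ) i) (Nat.cast_nonneg (α := ℝ) m)]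

theorem sum_inv_sq_le_two (n : ℕ) : ∑ k ∈ range n, (((k : ℝ) + 1)⁻¹) ^ 2 ≤ 2 := by
  rcases n with _ | n
  · simp
  have h : ∑ k ∈ range (n + 1), (((k : ℝ) + 1)⁻¹) ^ 2 ≤ 2 - ((n : ℝ) + 1)⁻¹ := by
    induction n with
    | zero => norm_num
    | succ n ih =>
      rw [sum_range_succ]
      push_cast
      have h1 : (((n : ℝ) + 1 + 1)⁻¹) ^ 2 ≤ ((n : ℝ) + 1)⁻¹ - ((n : ℝ) + 1 + 1)⁻¹ := by
        have h2 : ((n : ℝ) + 1)⁻¹ - ((n : ℝ) + 1 + 1)⁻¹ =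
            (((n : ℝ) + 1) * ((n : ℝ) + 1 + 1))⁻¹ := by
          field_simp
          ring
        rw [h2, inv_pow]
        refine inv_anti₀ (by positivity) ?_
        nlinarith [(Nat.cast_nonneg n : (0 : ℝ) ≤ n)]
      linarith
  have : 0 ≤ ((n : ℝ) + 1)⁻¹ := by positivity
  linarith

theorem sum_inv_abs_sub_sq_le_four {M : ℕ} (i : Fin M) :
    ∑ j : Fin M, (|(i : ℝ) - j|⁻¹) ^ 2 ≤ 4 := by
  rw [sum_fin_abs_sub (fun x => x⁻¹ ^ 2) (by simp) i]
  linarith [sum_inv_sq_le_two i, sum_inv_sq_le_two (M - 1 - i)]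

end Kernel
-- Weighted adversary method
section Adversary

variable {X Y : Type*} [Fintype Y] {k : ℕ} [NeZero k]

/-- The norm of the component of a state in which the query register contains `y`. -/
noncomputable def queryNorm {d : ℕ} (u : Basis Y k d → ℂ) (y : Y) : ℝ :=
  √(∑ c : ZMod k × Fin d, ‖u (y, c)‖ ^ 2)

theorem sum_queryNorm_sq {d : ℕ} (u : Basis Y k d → ℂ) :
    ∑ y, queryNorm u y ^ 2 = ∑ b, ‖u b‖ ^ 2 := by
  rw [Fintype.sum_prod_type]
  exact sum_congr rfl fun y _ => Real.sq_sqrt (sum_nonneg fun c _ => sq_nonneg _)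

variable [DecidableEq Y]

theorem oracle_mulVec {d : ℕ} (g : Y → ZMod k) (u : Basis Y k d → ℂ) (p : Basis Y k d) :
    Matrix.mulVec (oracle d g) u p = u (p.1, p.2.1 - g p.1, p.2.2) := by
  rw [Matrix.mulVec, dotProduct, sum_eq_single (p.1, p.2.1 - g p.1, p.2.2)]
  · simp [oracle]
  · rintro ⟨y, a, w⟩ _ hne
    rw [oracle, Matrix.of_apply, if_neg, zero_mul]
    rintro rfl
    exact hne (by simp)
  · simp

theorem norm_sum_star_mul_le {γ : Type*} [Fintype γ] (u v : γ → ℂ) :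
    ‖∑ c, star (u c) * v c‖ ≤ √(∑ c, ‖u c‖ ^ 2) * √(∑ c, ‖v c‖ ^ 2) := by
  refine (norm_sum_le _ _).trans ?_
  simp only [norm_mul, norm_star]
  exact Real.sum_mul_le_sqrt_mul_sqrt _ _ _

theorem queryNorm_oracle {d : ℕ} (g : Y → ZMod k) (u : Basis Y k d → ℂ) (y : Y) :
    queryNorm (Matrix.mulVec (oracle d g) u) y = queryNorm u y := by
  unfold queryNorm
  congr 1
  simp only [oracle_mulVec]
  exact Equiv.sum_comp ((Equiv.subRight (g y)).prodCongr (Equiv.refl (Fin d)))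
    (fun c => ‖u (y, c)‖ ^ 2)

/-- Within the block of `y` the oracle only shifts the answer register. Equal shifts preserve the
overlap; for different shifts Cauchy–Schwarz bounds the overlaps before and after, whence the factor
2. -/
theorem re_star_dotProduct_sub_oracle_le {d : ℕ} (g h : Y → ZMod k) (u v : Basis Y k d → ℂ) :
    (dotProduct (star u) v).re - (dotProduct (star (Matrix.mulVec (oracle d g) u))
      (Matrix.mulVec (oracle d h) v)).re ≤
      ∑ y, if g y = h y then 0 else 2 * (queryNorm u y * queryNorm v y) := by
  have hsplit : ∀ u v : Basis Y k d → ℂ, (dotProduct (star u) v).re =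
      ∑ y, (∑ c : ZMod k × Fin d, star (u (y, c)) * v (y, c)).re := by
    intro u v
    rw [dotProduct, Fintype.sum_prod_type, Complex.re_sum]
    rfl
  rw [hsplit, hsplit, ← sum_sub_distrib]
  refine sum_le_sum fun y _ => ?_
  split_ifs with hy
  · refine (sub_eq_zero.2 ?_).le
    congr 1
    simp only [oracle_mulVec, hy]
    exact (Equiv.sum_comp ((Equiv.subRight (h y)).prodCongr (Equiv.refl (Fin d)))
      (fun c => star (u (y, c)) * v (y, c))).symm
  · have h1 := (Complex.abs_re_le_norm _).trans
      (norm_sum_star_mul_le (fun c => u (y, c)) fun c => v (y, c))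
    have h2 := (Complex.abs_re_le_norm _).trans
      (norm_sum_star_mul_le (fun c => (oracle d g).mulVec u (y, c))
        fun c => (oracle d h).mulVec v (y, c))
    have h3 : √(∑ c, ‖(oracle d g).mulVec u (y, c)‖ ^ 2) *
        √(∑ c, ‖(oracle d h).mulVec v (y, c)‖ ^ 2) = queryNorm u y * queryNorm v y :=
      congr_arg₂ _ (queryNorm_oracle g u y) (queryNorm_oracle h v y)
    rw [h3] at h2
    change _ ≤ queryNorm u y * queryNorm v y at h1
    linarith [(abs_le.1 h1).2, (abs_le.1 h2).1]

theorem unitary_star_dotProduct {n : Type*} [Fintype n] [DecidableEq n]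
    (U : Matrix.unitaryGroup n ℂ) (u v : n → ℂ) :
    dotProduct (star (Matrix.mulVec (U : Matrix n n ℂ) u)) (Matrix.mulVec (U : Matrix n n ℂ) v) =
      dotProduct (star u) v := by
  rw [Matrix.star_mulVec, Matrix.dotProduct_mulVec, Matrix.vecMul_vecMul,
    ← Matrix.star_eq_conjTranspose, Matrix.UnitaryGroup.star_mul_self, Matrix.vecMul_one]

theorem star_dotProduct_self_re {n : Type*} [Fintype n] (u : n → ℂ) :
    (dotProduct (star u) u).re = ∑ b, ‖u b‖ ^ 2 := by
  rw [dotProduct, Complex.re_sum]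
  refine sum_congr rfl fun b _ => ?_
  rw [Pi.star_apply, Complex.star_def, ← Complex.normSq_eq_conj_mul_self, Complex.ofReal_re,
    Complex.normSq_eq_norm_sq]

namespace Algorithm

variable (A : Algorithm X Y k)

theorem sum_norm_sq_state (g : Y → ZMod k) (t : ℕ) : ∑ b, ‖A.state g t b‖ ^ 2 = 1 := by
  induction t with
  | zero =>
    rw [← star_dotProduct_self_re, state, unitary_star_dotProduct, star_dotProduct_self_re,
      sum_eq_single A.start]
    · simp
    · intro b _ hb
      simp [hb]
    · simp
  | succ t ih =>
    rw [← star_dotProduct_self_re, state, unitary_star_dotProduct, star_dotProduct_self_re,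
      ← sum_queryNorm_sq]
    simp only [queryNorm_oracle]
    rw [sum_queryNorm_sq, ih]

theorem state_zero (g h : Y → ZMod k) : A.state g 0 = A.state h 0 := rfl

/-- The weighted sum of the overlaps of the states after `t` queries to the oracles `g i`. -/
noncomputable def progress {ι : Type*} [Fintype ι] (g : ι → Y → ZMod k) (Γ : ι → ι → ℝ)
    (t : ℕ) : ℝ :=
  ∑ i, ∑ j, Γ i j * (dotProduct (star (A.state (g i) t)) (A.state (g j) t)).re

theorem progress_zero {ι : Type*} [Fintype ι] (g : ι → Y → ZMod k) (Γ : ι → ι → ℝ) :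
    A.progress g Γ 0 = ∑ i, ∑ j, Γ i j := by
  refine sum_congr rfl fun i _ => sum_congr rfl fun j _ => ?_
  rw [A.state_zero (g j) (g i), star_dotProduct_self_re, sum_norm_sq_state, mul_one]

/-- The kernel bound is applied for each `y` to the query amplitudes at `y`; their squares sum over
`y` to 1 for each input. -/
theorem progress_sub_succ_le {ι : Type*} [Fintype ι] (g : ι → Y → ZMod k) (Γ : ι → ι → ℝ)
    (hΓ : ∀ i j, 0 ≤ Γ i j) (C : ℝ)
    (hC : ∀ y (n : ι → ℝ), ∑ i, ∑ j, (if g i y = g j y then 0 else Γ i j) * (n i * n j) ≤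
      C * ∑ i, n i ^ 2) (t : ℕ) :
    A.progress g Γ t - A.progress g Γ (t + 1) ≤ 2 * C * Fintype.card ι := by
  set q : ι → Y → ℝ := fun i y => queryNorm (A.state (g i) t) y
  calc A.progress g Γ t - A.progress g Γ (t + 1)
      ≤ ∑ i, ∑ j, Γ i j * ∑ y, if g i y = g j y then 0 else 2 * (q i y * q j y) := by
        simp only [progress, state, unitary_star_dotProduct, ← sum_sub_distrib, ← mul_sub]
        exact sum_le_sum fun i _ => sum_le_sum fun j _ =>
          mul_le_mul_of_nonneg_left (re_star_dotProduct_sub_oracle_le _ _ _ _) (hΓ i j)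
    _ = ∑ y, 2 * ∑ i, ∑ j, (if g i y = g j y then 0 else Γ i j) * (q i y * q j y) := by
        simp only [mul_sum]
        rw [sum_comm]
        conv_rhs => rw [sum_comm]
        rw [sum_comm]
        refine sum_congr rfl fun i _ => ?_
        rw [sum_comm]
        refine sum_congr rfl fun j _ => sum_congr rfl fun y _ => ?_
        split_ifs <;> ring
    _ ≤ ∑ y, 2 * (C * ∑ i, q i y ^ 2) :=
        sum_le_sum fun y _ => mul_le_mul_of_nonneg_left (hC y fun i => q i y) zero_le_two
    _ = 2 * C * ∑ i, ∑ y, q i y ^ 2 := by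
        rw [sum_comm (f := fun i y => q i y ^ 2), mul_sum]
        exact sum_congr rfl fun y _ => by ring
    _ = 2 * C * Fintype.card ι := by
        simp only [q, sum_queryNorm_sq, sum_norm_sq_state]
        simp

theorem progress_zero_sub_le {ι : Type*} [Fintype ι] (g : ι → Y → ZMod k) (Γ : ι → ι → ℝ)
    (hΓ : ∀ i j, 0 ≤ Γ i j) (C : ℝ)
    (hC : ∀ y (n : ι → ℝ), ∑ i, ∑ j, (if g i y = g j y then 0 else Γ i j) * (n i * n j) ≤
      C * ∑ i, n i ^ 2) (t : ℕ) :
    A.progress g Γ 0 - A.progress g Γ t ≤ 2 * C * Fintype.card ι * t := by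
  induction t with
  | zero => simp
  | succ t ih =>
    have := A.progress_sub_succ_le g Γ hΓ C hC t
    push_cast
    linarith

/-- Overlaps of states which can be told apart with a fixed probability of success: only the
failing components contribute with their full weight. -/
theorem progress_queries_le [DecidableEq X] {ι : Type*} [Fintype ι] (g : ι → Y → ZMod k)
    (x : ι → X) (hx : Function.Injective x) (Γ : ι → ι → ℝ) (hΓ : ∀ i j, 0 ≤ Γ i j)
    (hsymm : ∀ i j, Γ i j = Γ j i) (D : ℝ) (hD : ∀ i, ∑ j, Γ i j ^ 2 ≤ D) :
    A.progress g Γ A.queries ≤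
      ∑ i, (∑ j, Γ i j) * A.failureProb (g i) (x i) + (D + 1) * Fintype.card ι := by
  set ψ : ι → Basis Y k A.dim → ℝ := fun i b => ‖A.state (g i) A.queries b‖ with hψ
  have hψ1 : ∀ i, ∑ b, ψ i b ^ 2 = 1 := fun i => A.sum_norm_sq_state (g i) A.queries
  have pointwise : ∀ b, ∑ i, ∑ j, Γ i j * (ψ i b * ψ j b) ≤
      ∑ i, (∑ j, Γ i j) * (if A.output b = x i then 0 else ψ i b ^ 2) +
        (D + 1) * ∑ i, ψ i b ^ 2 := by
    intro b
    -- If outcome `b` is wrong for both `i` and `j`, plain AM-GM suffices. If it is right for one of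
    -- them, the weight is put on that one: `2Γψφ ≤ Γ²ψ² + φ²`.
    let G : ι → ι → ℝ := fun i j => Γ i j * (if A.output b = x i then 0 else ψ i b ^ 2) +
      (Γ i j ^ 2 * ψ i b ^ 2 + if A.output b = x i then ψ j b ^ 2 else 0)
    have hG : ∀ i j, 2 * (Γ i j * (ψ i b * ψ j b)) ≤ G i j + G j i := by
      intro i j
      simp only [G, hsymm j i]
      have h0 := hΓ i j
      have h1 : 2 * (Γ i j * (ψ i b * ψ j b)) ≤ Γ i j * ψ i b ^ 2 + Γ i j * ψ j b ^ 2 := by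
        nlinarith [mul_nonneg h0 (sq_nonneg (ψ i b - ψ j b))]
      have h2 : 2 * (Γ i j * (ψ i b * ψ j b)) ≤ Γ i j ^ 2 * ψ i b ^ 2 + ψ j b ^ 2 := by
        nlinarith [sq_nonneg (Γ i j * ψ i b - ψ j b)]
      have h3 : 2 * (Γ i j * (ψ i b * ψ j b)) ≤ Γ i j ^ 2 * ψ j b ^ 2 + ψ i b ^ 2 := by
        nlinarith [sq_nonneg (Γ i j * ψ j b - ψ i b)]
      have h4 : 0 ≤ Γ i j ^ 2 * ψ i b ^ 2 := by positivity
      have h5 : 0 ≤ Γ i j ^ 2 * ψ j b ^ 2 := by positivity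
      have h6 : 0 ≤ Γ i j * ψ i b ^ 2 := by positivity
      have h7 : 0 ≤ Γ i j * ψ j b ^ 2 := by positivity
      have h8 := sq_nonneg (ψ i b)
      have h9 := sq_nonneg (ψ j b)
      split_ifs <;> linarith
    have hsum : ∑ i, ∑ j, Γ i j * (ψ i b * ψ j b) ≤ ∑ i, ∑ j, G i j := by
      have h1 : ∑ i, ∑ j, 2 * (Γ i j * (ψ i b * ψ j b)) ≤ ∑ i, ∑ j, (G i j + G j i) :=
        sum_le_sum fun i _ => sum_le_sum fun j _ => hG i j
      simp only [sum_add_distrib, ← mul_sum] at h1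
      rw [sum_comm (f := fun i j => G j i)] at h1
      linarith
    refine hsum.trans ?_
    simp only [G, sum_add_distrib, ← sum_mul]
    have h1 : ∑ i, (∑ j, Γ i j ^ 2) * ψ i b ^ 2 ≤ D * ∑ i, ψ i b ^ 2 := by
      rw [mul_sum]
      exact sum_le_sum fun i _ => mul_le_mul_of_nonneg_right (hD i) (sq_nonneg _)
    -- An outcome is correct for at most one `i`, so each `ψ j b ^ 2` is charged at most once.
    have h2 : ∑ i, ∑ j, (if A.output b = x i then ψ j b ^ 2 else 0) ≤ ∑ j, ψ j b ^ 2 := by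
      rw [sum_comm]
      refine sum_le_sum fun j _ => ?_
      rw [← sum_filter, sum_const, nsmul_eq_mul]
      have hcard : (#(univ.filter fun i => A.output b = x i)) ≤ 1 :=
        card_le_one.2 fun i hi j hj =>
          hx ((mem_filter.1 hi).2.symm.trans (mem_filter.1 hj).2)
      calc _ ≤ (1 : ℝ) * ψ j b ^ 2 :=
            mul_le_mul_of_nonneg_right (by exact_mod_cast hcard) (sq_nonneg _)
        _ = _ := one_mul _
    linarith
  calc A.progress g Γ A.queries ≤ ∑ i, ∑ j, Γ i j * ∑ b, ψ i b * ψ j b := by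
        refine sum_le_sum fun i _ => sum_le_sum fun j _ =>
          mul_le_mul_of_nonneg_left ?_ (hΓ i j)
        refine (Complex.re_le_norm _).trans ((norm_sum_le _ _).trans (le_of_eq ?_))
        simp [hψ]
    _ = ∑ b, ∑ i, ∑ j, Γ i j * (ψ i b * ψ j b) := by
        simp only [mul_sum]
        rw [sum_comm (s := (univ : Finset (Basis Y k A.dim)))]
        refine sum_congr rfl fun i _ => ?_
        rw [sum_comm]
    _ ≤ ∑ b, (∑ i, (∑ j, Γ i j) * (if A.output b = x i then 0 else ψ i b ^ 2) +
        (D + 1) * ∑ i, ψ i b ^ 2) := sum_le_sum fun b _ => pointwise b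
    _ = _ := by
        rw [sum_add_distrib, sum_comm, ← mul_sum,
          sum_comm (f := fun b i => ψ i b ^ 2)]
        simp only [hψ1, ← mul_sum, failureProb]
        simp [hψ]

theorem failureProb_nonneg [DecidableEq X] (g : Y → ZMod k) (x : X) : 0 ≤ A.failureProb g x :=
  sum_nonneg fun b _ => by split_ifs <;> positivity

theorem one_sub_failureProb [DecidableEq X] (g : Y → ZMod k) (x : X) :
    1 - A.failureProb g x = ∑ b, if A.output b = x then ‖A.state g A.queries b‖ ^ 2 else 0 := by
  rw [← A.sum_norm_sq_state g A.queries, failureProb, ← sum_sub_distrib]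
  exact sum_congr rfl fun b _ => by split_ifs <;> ring

theorem sum_one_sub_failureProb [Fintype X] [DecidableEq X] (g : Y → ZMod k) :
    ∑ x, (1 - A.failureProb g x) = 1 := by
  simp only [one_sub_failureProb]
  rw [sum_comm]
  simp [A.sum_norm_sq_state g A.queries]

theorem one_sub_avgFailureProb [Fintype X] [DecidableEq X] (f : X → Y → ZMod k) (μ : PMF X)
    (hμ : ∑ x, (μ x).toReal = 1) :
    1 - A.avgFailureProb f μ = ∑ x, (μ x).toReal * (1 - A.failureProb (f x) x) := by
  simp only [avgFailureProb, mul_sub, mul_one, sum_sub_distrib, hμ]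

end Algorithm

end Adversary

/-! ### Worst-case ordered search on a subset -/

section OrderedSearch

theorem GT_eq_iff {N : ℕ} (x x' y : Fin N) : GT N x y = GT N x' y ↔ (x ≤ y ↔ x' ≤ y) := by
  unfold GT
  by_cases h : y < x <;> by_cases h' : y < x' <;> simp [h, h', not_le.2, not_lt.1]

/-- A lower bound for ordered search with success probability bounded away from zero. -/
theorem log_card_le_of_failureProb_le {N : ℕ} (A : Algorithm (Fin N) (Fin N) 2)
    (S : Finset (Fin N)) (hS : ∀ x ∈ S, A.failureProb (GT N x) x ≤ 3 / 4) :
    Real.log #S ≤ 64 * A.queries + 20 := by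
  rcases S.eq_empty_or_nonempty with rfl | hne
  · simp
    positivity
  set M := #S with hM
  have hMpos : (0 : ℝ) < M := by exact_mod_cast hne.card_pos
  let e := S.orderEmbOfFin hM.symm
  let Γ : Fin M → Fin M → ℝ := fun i j => |(i : ℝ) - j|⁻¹
  have hΓ : ∀ i j, 0 ≤ Γ i j := fun i j => by positivity
  have hquery : ∀ (y : Fin N) (n : Fin M → ℝ),
      ∑ i, ∑ j, (if GT N (e i) y = GT N (e j) y then 0 else Γ i j) * (n i * n j) ≤
        8 * ∑ i, n i ^ 2 := by
    intro y n
    simp only [GT_eq_iff]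
    exact sum_cut_inv_abs_sub_le (fun i => e i ≤ y)
      (fun i j hij hj => (e.monotone hij).trans hj) n
  have h1 := A.progress_zero_sub_le (fun i => GT N (e i)) Γ hΓ 8 hquery A.queries
  have h2 := A.progress_queries_le (fun i => GT N (e i)) e e.injective Γ hΓ
    (fun i j => by simp only [Γ]; rw [abs_sub_comm]) 4 sum_inv_abs_sub_sq_le_four
  rw [A.progress_zero] at h1
  rw [Fintype.card_fin] at h1 h2
  -- Failure at most 3/4 leaves a quarter of each row sum, so `log M / 4 ≤ 2·8·queries + (4 + 1)`.
  have h3 : ∑ i : Fin M, Real.log M / 4 ≤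
      ∑ i, ∑ j, Γ i j - ∑ i, (∑ j, Γ i j) * A.failureProb (GT N (e i)) (e i) := by
    rw [← sum_sub_distrib]
    refine sum_le_sum fun i _ => ?_
    have hf := hS (e i) (S.orderEmbOfFin_mem hM.symm i)
    have hr : Real.log M ≤ ∑ j, Γ i j := log_le_sum_inv_abs_sub i
    have hr0 : 0 ≤ ∑ j, Γ i j := sum_nonneg fun j _ => hΓ i j
    nlinarith
  rw [sum_const, card_univ, Fintype.card_fin, nsmul_eq_mul] at h3
  have h4 : (M : ℝ) * Real.log M ≤ M * (64 * A.queries + 20) := by linarith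
  exact le_of_mul_le_mul_left h4 hMpos

end OrderedSearch

/-! ### Smooth max-entropy by conditioning -/

section Entropy

variable {X : Type*} [Fintype X]

theorem sum_toReal_eq_one (μ : PMF X) : ∑ x, (μ x).toReal = 1 := by
  rw [← ENNReal.toReal_sum fun x _ => μ.apply_ne_top x,
    ← tsum_fintype (L := .unconditional _), μ.tsum_coe, ENNReal.toReal_one]

/-- The witness is `μ` conditioned on `S`, at distance `1 - μ(S)` from `μ`. -/
theorem smoothMaxEntropy_le_logb_card [DecidableEq X] (μ : PMF X) (S : Finset X) (ε : ℝ)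
    (hε : ε < 1) (hS : 1 - ε ≤ ∑ x ∈ S, (μ x).toReal) :
    smoothMaxEntropy ε μ ≤ Real.logb 2 #S := by
  have hpos : 0 < ∑ x ∈ S, (μ x).toReal := by linarith
  obtain ⟨a, haS, ha⟩ := exists_ne_zero_of_sum_ne_zero hpos.ne'
  let ν : PMF X := μ.filter (S : Set X) ⟨a, haS, (μ.mem_support_iff a).2 fun h => ha (by simp [h])⟩
  set m := ∑ x ∈ S, (μ x).toReal with hm
  have hm1 : m ≤ 1 := by
    rw [← sum_toReal_eq_one μ]
    exact sum_le_sum_of_subset_of_nonneg (subset_univ S) fun x _ _ => ENNReal.toReal_nonneg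
  have hind : ∀ x, ((S : Set X).indicator μ x).toReal = if x ∈ S then (μ x).toReal else 0 := by
    intro x
    by_cases hx : x ∈ S <;> simp [hx]
  have hν : ∀ x, (ν x).toReal = if x ∈ S then (μ x).toReal * m⁻¹ else 0 := by
    intro x
    have hsum : ∑ y, ((S : Set X).indicator μ y).toReal = m := by
      simp only [hind, hm, sum_ite_mem, univ_inter]
    rw [PMF.filter_apply, tsum_fintype, ENNReal.toReal_mul, ENNReal.toReal_inv,
      ENNReal.toReal_sum, hsum, hind, ite_mul, zero_mul]
    exact fun y _ => ((Set.indicator_le_self _ _ y).trans_lt (μ.apply_lt_top y)).ne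
  have htv : tvDist μ ν ≤ ε := by
    have habs : ∀ x, |(μ x).toReal - (ν x).toReal| =
        (μ x).toReal + (m⁻¹ - 2) * if x ∈ S then (μ x).toReal else 0 := by
      intro x
      have h0 : 0 ≤ (μ x).toReal := ENNReal.toReal_nonneg
      have h1 : 1 ≤ m⁻¹ := (one_le_inv₀ hpos).2 hm1
      rw [hν]
      split_ifs with hx
      · rw [abs_of_nonpos (by nlinarith)]
        ring
      · rw [sub_zero, abs_of_nonneg h0]
        ring
    simp only [tvDist, habs, sum_add_distrib, ← mul_sum, sum_ite_mem, univ_inter,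
      sum_toReal_eq_one, ← hm]
    have : (m⁻¹ - 2) * m = 1 - 2 * m := by
      field_simp
    rw [this]
    linarith
  have hsupp : ν.support ⊆ S := by
    rw [PMF.support_filter]
    exact Set.inter_subset_left
  have hcard : ν.support.ncard ≤ #S := by
    rw [← Set.ncard_coe_finset]
    exact Set.ncard_le_ncard hsupp S.finite_toSet
  have hcard0 : 0 < ν.support.ncard :=
    (Set.ncard_pos (S.finite_toSet.subset hsupp)).2 ν.support_nonempty
  have hbdd : BddBelow {h : ℝ | ∃ ν : PMF X, tvDist μ ν ≤ ε ∧
      h = Real.logb 2 (ν.support.ncard : ℝ)} := by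
    refine ⟨0, ?_⟩
    rintro _ ⟨ρ, -, rfl⟩
    exact div_nonneg (Real.log_natCast_nonneg _) (Real.log_nonneg one_le_two)
  refine (csInf_le hbdd ⟨ν, htv, rfl⟩).trans ?_
  exact Real.logb_le_logb_of_le one_lt_two (by exact_mod_cast hcard0) (by exact_mod_cast hcard)

end Entropy

/-! ### From average success to the entropy bound -/

section LowerBound

variable {N : ℕ} (A : Algorithm (Fin N) (Fin N) 2) (μ : PMF (Fin N))

/-- The inputs on which the algorithm succeeds with probability at least `1 / 4` have mass at
least `1 / 2`. -/
theorem half_le_sum_filter_failureProb (hA : A.avgFailureProb (GT N) μ ≤ 1 / 3) :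
    1 - 1 / 2 ≤ ∑ x with A.failureProb (GT N x) x ≤ 3 / 4, (μ x).toReal := by
  have h := A.one_sub_avgFailureProb (GT N) μ (sum_toReal_eq_one μ)
  -- Success is at most 1 on good inputs and 1/4 elsewhere, so `2/3 ≤ 1/4 + (3/4)m`, and the good
  -- mass `m` is at least 5/9.
  have h1 : ∑ x, (μ x).toReal * (1 - A.failureProb (GT N x) x) ≤
      ∑ x, ((1 / 4) * (μ x).toReal +
        (3 / 4) * if A.failureProb (GT N x) x ≤ 3 / 4 then (μ x).toReal else 0) := by
    refine sum_le_sum fun x _ => ?_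
    have h0 : 0 ≤ (μ x).toReal := ENNReal.toReal_nonneg
    have hf := A.failureProb_nonneg (GT N x) x
    split_ifs with hx
    · nlinarith
    · nlinarith [not_le.1 hx]
  rw [sum_add_distrib, ← mul_sum, ← mul_sum, ← sum_filter, sum_toReal_eq_one] at h1
  linarith

/-- An algorithm without queries can only succeed if a single input has large mass. -/
theorem exists_half_le_of_queries_eq_zero (hA : A.avgFailureProb (GT N) μ ≤ 1 / 3)
    (hq : A.queries = 0) : ∃ x, 1 - 1 / 2 ≤ (μ x).toReal := by
  by_contra! hlt
  have h := A.one_sub_avgFailureProb (GT N) μ (sum_toReal_eq_one μ)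
  have hconst : ∀ x x', A.failureProb (GT N x) x' = A.failureProb 0 x' := by
    intro x x'
    simp only [Algorithm.failureProb, hq, A.state_zero (GT N x) 0]
  -- The output law does not depend on `x`, so with all masses below 1/2 the success is at most 1/2,
  -- less than 2/3.
  have h1 : ∑ x, (μ x).toReal * (1 - A.failureProb (GT N x) x) ≤
      ∑ x, (1 - 1 / 2) * (1 - A.failureProb 0 x) := by
    refine sum_le_sum fun x _ => ?_
    rw [hconst]
    refine mul_le_mul_of_nonneg_right (hlt x).le ?_
    rw [A.one_sub_failureProb]
    exact sum_nonneg fun b _ => by split_ifs <;> positivity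
  rw [← mul_sum, A.sum_one_sub_failureProb] at h1
  linarith

/-- One query absorbs the additive constant: `64q + 20 ≤ 84q`. For `q = 0` a single input carries
half the mass, so the entropy is at most 0. -/
theorem smoothMaxEntropy_le_queries (hA : A.avgFailureProb (GT N) μ ≤ 1 / 3) :
    Real.log 2 / 84 * smoothMaxEntropy (1 / 2) μ ≤ A.queries := by
  have hlog : 0 < Real.log 2 := Real.log_pos one_lt_two
  have hc : 0 ≤ Real.log 2 / 84 := by positivity
  rcases Nat.eq_zero_or_pos A.queries with hq | hq
  · obtain ⟨x, hx⟩ := exists_half_le_of_queries_eq_zero A μ hA hq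
    have h := smoothMaxEntropy_le_logb_card μ {x} (1 / 2) (by norm_num) (by rwa [sum_singleton])
    rw [card_singleton, Nat.cast_one, Real.logb_one] at h
    rw [hq, Nat.cast_zero]
    exact mul_nonpos_of_nonneg_of_nonpos hc h
  · let S : Finset (Fin N) := univ.filter fun x => A.failureProb (GT N x) x ≤ 3 / 4
    have h := smoothMaxEntropy_le_logb_card μ S (1 / 2) (by norm_num)
      (half_le_sum_filter_failureProb A μ hA)
    have hS := log_card_le_of_failureProb_le A S fun x hx => (mem_filter.1 hx).2
    have hq1 : (1 : ℝ) ≤ A.queries := by exact_mod_cast hq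
    calc Real.log 2 / 84 * smoothMaxEntropy (1 / 2) μ
        ≤ Real.log 2 / 84 * Real.logb 2 #S := mul_le_mul_of_nonneg_left h hc
      _ = Real.log #S / 84 := by
          rw [Real.logb]
          field_simp
      _ ≤ A.queries := by linarith

end LowerBound

end QuantumQuery

theorem mainTheorem10 :
    ∃ c : ℝ, 0 < c ∧ ∀ (N : ℕ) (μ : PMF (Fin N)),
      ENNReal.ofReal (c * QuantumQuery.smoothMaxEntropy (1 / 2) μ) ≤
        (QuantumQuery.distComplexity (QuantumQuery.GT N) μ (1 / 3) : ℝ≥0∞) := by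
  refine ⟨Real.log 2 / 84, div_pos (Real.log_pos one_lt_two) (by norm_num), fun N μ => ?_⟩
  rw [QuantumQuery.distComplexity]
  rcases isEmpty_or_nonempty {A : QuantumQuery.Algorithm (Fin N) (Fin N) 2 //
      A.avgFailureProb (QuantumQuery.GT N) μ ≤ 1 / 3} with hE | hE
  · rw [iInf_of_empty, ENat.toENNReal_top]
    exact le_top
  -- A nonempty infimum in `ℕ∞` is attained, so one optimal algorithm suffices.
  · obtain ⟨A, hA⟩ := ciInf_mem fun A : {A : QuantumQuery.Algorithm (Fin N) (Fin N) 2 //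
      A.avgFailureProb (QuantumQuery.GT N) μ ≤ 1 / 3} => (A.1.queries : ℕ∞)
    rw [← hA, ENat.toENNReal_coe]
    exact ENNReal.ofReal_le_of_le_toReal
      (by simpa using QuantumQuery.smoothMaxEntropy_le_queries A.1 μ A.2)
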